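/- Let $k$ be a field. Let $\mathcal{C}$ be the category whose objects are the finite sets, in which a morphism from $X$ to $Y$ is a correspondence, that is, a subset of $Y\times X$, with the usual composition $RS=\{(z,x)\mid \exists\, y\in Y,\ (z,y)\in R \text{ and } (y,x)\in S\}$ for $R\subseteq Z\times Y$ and $S\subseteq Y\times X$, and with the diagonals as identities. A correspondence functor over $k$ is a functor from $\mathcal{C}$ to the category of $k$-modules (equivalently, a $k$-linear functor on the $k$-linearization of $\mathcal{C}$); correspondence functors and natural transformations form the abelian category $\mathcal{F}_k$. A correspondence functor $M$ is finitely generated if there are finitely many elements $m_i\in M(E_i)$, with $E_i$ finite sets, such that for every finite set $X$ every element of $M(X)$ is a $k$-linear combination of elements $M(S)(m_i)$, where $S$ is a correspondence from $E_i$ to $X$. It is projective if it is a projective object of $\mathcal{F}_k$. Let $\operatorname{Rad}(M)$ be the intersection of all maximal proper subfunctors of $M$, and let $\operatorname{Soc}(M)$ be the sum of all simple subfunctors of $M$. Then: (a) For every finitely generated projective correspondence functor $M$ over $k$, there is an isomorphism $M/\operatorname{Rad}(M)\cong\operatorname{Soc}(M)$ in $\mathcal{F}_k$. (b) For all finitely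 generated correspondence functors $M$ and $N$ over $k$ such that $M$ is projective, $$\dim_k\operatorname{Hom}_{\mathcal{F}_k}(M,N)=\dim_k\operatorname{Hom}_{\mathcal{F}_k}(N,M)<\infty.$$ -/

import Mathlib

open CategoryTheory

universe u

/-- A finite set (an object of the category of finite sets and correspondences). -/
structure FinCorr : Type (u + 1) where
  /-- The underlying set. -/
  carrier : Type u
  [finite : Finite carrier]

namespace FinCorr

attribute [instance] FinCorr.finite

/-- A correspondence from `X` to `Y`: a subset of `Y × X`. -/
@[ext]
structure Hom (X Y : FinCorr.{u}) : Type u where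
  /-- The underlying subset of `Y × X`. -/
  graph : Set (Y.carrier × X.carrier)

/-- The category of finite sets and correspondences. The morphism `S ≫ R` is the product `RS`
of correspondences, and the identity of `X` is the diagonal of `X × X`. -/
instance : Category.{u} FinCorr.{u} where
  Hom X Y := Hom X Y
  id X := ⟨{p | p.1 = p.2}⟩
  comp {X Y Z} S R := ⟨{p | ∃ y : Y.carrier, (p.1, y) ∈ R.graph ∧ (y, p.2) ∈ S.graph}⟩
  id_comp S := by
    apply Hom.ext
    ext ⟨y, x⟩
    simp
  comp_id S := by
    apply Hom.ext
    ext ⟨y, x⟩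
    simp
  assoc S R T := by
    apply Hom.ext
    ext ⟨z, x⟩
    constructor
    · rintro ⟨a, h, b, h', h''⟩
      exact ⟨b, ⟨a, h, h'⟩, h''⟩
    · rintro ⟨b, ⟨a, h, h'⟩, h''⟩
      exact ⟨a, h, b, h', h''⟩

end FinCorr

/-- A correspondence functor over `k`: a functor from the category of finite sets and
correspondences to the category of `k`-modules. Morphisms are natural transformations. -/
abbrev CorrFunctor (k : Type u) [CommRing k] : Type (u + 1) :=
  FinCorr.{u} ⥤ ModuleCat.{u} k

namespace CorrFunctor

variable {k : Type u} [CommRing k]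

/-- `M` is finitely generated: there are finitely many elements `m i ∈ M (E i)` such that, for
every finite set `X`, every element of `M X` is a `k`-linear combination of elements `S • m i`,
where `S` is a correspondence from `E i` to `X`. -/
def FinitelyGenerated (M : CorrFunctor k) : Prop :=
  ∃ (n : ℕ) (E : Fin n → FinCorr.{u}) (m : ∀ i, M.obj (E i)), ∀ (X : FinCorr.{u}) (x : M.obj X),
    x ∈ Submodule.span k {y : M.obj X | ∃ (i : Fin n) (S : E i ⟶ X), y = (M.map S).hom (m i)}

/-- A subfunctor of a correspondence functor. -/
@[ext]
structure Sub (M : CorrFunctor k) : Type (u + 1) where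
  /-- The submodule `N X` of `M X`. -/
  obj : ∀ X : FinCorr.{u}, Submodule k (M.obj X)
  map_mem : ∀ {X Y : FinCorr.{u}} (S : X ⟶ Y) {x : M.obj X}, x ∈ obj X → (M.map S).hom x ∈ obj Y

namespace Sub

variable {M : CorrFunctor k}

/-- Subfunctors are ordered by inclusion. -/
instance : PartialOrder (Sub M) :=
  PartialOrder.lift Sub.obj fun _ _ h => Sub.ext h

/-- The zero subfunctor. -/
instance : OrderBot (Sub M) where
  bot :=
    { obj := fun _ => ⊥
      map_mem := by
        intro X Y S x hx
        rw [Submodule.mem_bot] at hx ⊢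
        rw [hx, map_zero] }
  bot_le N := fun X => (bot_le : (⊥ : Submodule k (M.obj X)) ≤ N.obj X)

/-- `M` as a subfunctor of itself. -/
instance : OrderTop (Sub M) where
  top :=
    { obj := fun _ => ⊤
      map_mem := fun _ _ _ => Submodule.mem_top }
  le_top N := fun X => (le_top : N.obj X ≤ (⊤ : Submodule k (M.obj X)))

/-- The sum of a set of subfunctors. -/
def sum (A : Set (Sub M)) : Sub M where
  obj X := ⨆ N ∈ A, N.obj X
  map_mem {X Y} S x hx := by
    have h : (⨆ N ∈ A, N.obj X) ≤ (⨆ N ∈ A, N.obj Y).comap (M.map S).hom :=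
      iSup₂_le fun N hN y hy => (le_iSup₂_of_le N hN le_rfl : N.obj Y ≤ _) (N.map_mem S hy)
    exact h hx

/-- The intersection of a set of subfunctors (`M` itself if the set is empty). -/
def inter (A : Set (Sub M)) : Sub M where
  obj X := ⨅ N ∈ A, N.obj X
  map_mem {X Y} S x hx := by
    simp only [Submodule.mem_iInf] at hx ⊢
    exact fun N hN => N.map_mem S (hx N hN)

/-- A subfunctor, viewed as a correspondence functor. -/
def toFunctor (N : Sub M) : CorrFunctor k where
  obj X := ModuleCat.of k (N.obj X)
  map S := ModuleCat.ofHom ((M.map S).hom.restrict fun _ hx => N.map_mem S hx)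
  map_id X := by
    ext x
    simp [LinearMap.restrict_apply]
  map_comp S R := by
    ext x
    simp [LinearMap.restrict_apply]

/-- The quotient functor `M / N`. -/
def quotient (N : Sub M) : CorrFunctor k where
  obj X := ModuleCat.of k (M.obj X ⧸ N.obj X)
  map {X Y} S := ModuleCat.ofHom
    ((N.obj X).mapQ (N.obj Y) (M.map S).hom fun _ hx => N.map_mem S hx)
  map_id X := by
    ext x
    simp
  map_comp S R := by
    ext x
    simp

end Sub

/-- The radical of `M`: the intersection of all maximal (proper) subfunctors. -/
def radical (M : CorrFunctor k) : Sub M :=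
  Sub.inter {N | IsCoatom N}

/-- The socle of `M`: the sum of all simple (that is, minimal nonzero) subfunctors. -/
def socle (M : CorrFunctor k) : Sub M :=
  Sub.sum {N | IsAtom N}

end CorrFunctor

/-! ### Symmetric algebras: duality between `Hom(P, Q)` and `Hom(Q, P)`. -/

section ModuleTheory

variable {k A : Type*} [Field k] [Ring A] [Algebra k A]

/-! Write kC(X, Y) for the span of the correspondences from X to Y, and A = kC(E, E). Let t be the
linear form on A with t(R) = 1 if R misses the diagonal and 0 otherwise. It makes A a symmetric
algebra; more generally, (S, a) ↦ t(Sa) is a perfect pairing of kC(X, E) with kC(E, X) for every X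
(`eq_zero_of_trace_post_eq_zero`, `exists_trace_post_eq`).

A finitely generated projective M is a direct summand of finitely many copies of kC(E, -) for a
single E (`exists_dualBasis`). Evaluation at E identifies Hom(M, N) with Hom_A(M(E), N(E)) by
Yoneda, and Hom(N, M) with Hom_A(N(E), M(E)) by the perfect pairing (`bijective_evalHom_left`,
`bijective_evalHom_right`). Since M(E) is projective over a symmetric algebra, Hom_A(M(E), Q) and
Hom_A(Q, M(E)) are dual for every finite-dimensional Q (`finrank_linearMap_comm_of_symmetric`),
which gives (b).

For (a), taking Q simple shows that the top and the socle of M(E) have the same multiplicities, so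
they are isomorphic. The functors M/Rad(M) and Soc(M) are both generated by their value at E and
detected by correspondences to E; such functors are determined by the A-module at E
(`nonempty_iso_of_fiber`). -/

theorem Module.Finite.linearMap_of_algebra (P Q : Type*)
    [AddCommGroup P] [Module k P] [Module A P] [IsScalarTower k A P] [Module.Finite k P]
    [AddCommGroup Q] [Module k Q] [Module A Q] [IsScalarTower k A Q] [Module.Finite k Q] :
    Module.Finite k (P →ₗ[A] Q) :=
  Module.Finite.of_injective (LinearMap.restrictScalarsₗ k A P Q k)
    (LinearMap.restrictScalars_injective k)

/-- A nondegenerate form on a finite-dimensional algebra identifies the linear functionals on a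
module with the module homomorphisms to the algebra. -/
theorem exists_linearMap_of_nondegenerate [Module.Finite k A] (t : A →ₗ[k] k)
    (nd : ∀ a, (∀ b, t (b * a) = 0) → a = 0) {Q : Type*}
    [AddCommGroup Q] [Module k Q] [Module A Q] [IsScalarTower k A Q] (l : Q →ₗ[k] k) :
    ∃ ψ : Q →ₗ[A] A, ∀ q, t (ψ q) = l q := by
  -- Nondegeneracy makes `D` injective, hence bijective by dimension; `ψ q` is the preimage of `b ↦
  -- l (b • q)`.
  let D : A →ₗ[k] Module.Dual k A :=
    LinearMap.mk₂ k (fun a b => t (b * a)) (fun _ _ _ => by simp [mul_add]) (fun _ _ _ => by simp)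
      (fun _ _ _ => by simp [add_mul]) (fun _ _ _ => by simp)
  have hD (a b : A) : D a b = t (b * a) := rfl
  have inj : Function.Injective D := by
    rw [injective_iff_map_eq_zero]
    exact fun a ha => nd a fun b => by rw [← hD, ha, LinearMap.zero_apply]
  have surj : Function.Surjective D :=
    (LinearMap.injective_iff_surjective_of_finrank_eq_finrank Subspace.dual_finrank_eq.symm).1 inj
  have ex (q : Q) : ∃ a : A, ∀ b, t (b * a) = l (b • q) := by
    obtain ⟨a, ha⟩ := surj (l ∘ₗ (LinearMap.toSpanSingleton A Q q).restrictScalars k)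
    exact ⟨a, fun b => by rw [← hD, ha]; simp⟩
  have uniq {a a' : A} (h : ∀ b, t (b * a) = t (b * a')) : a = a' :=
    inj (LinearMap.ext fun b => h b)
  choose ψ hψ using ex
  refine ⟨{ toFun := ψ, map_add' := fun x y => uniq fun b => ?_,
            map_smul' := fun a x => uniq fun b => ?_ }, fun q => ?_⟩
  · rw [hψ, mul_add, map_add, hψ, hψ, smul_add, map_add]
  · rw [hψ, RingHom.id_apply, smul_eq_mul, ← mul_assoc, hψ, mul_smul]
  · simpa using hψ q 1

/-- Over a finite-dimensional symmetric algebra, a finitely generated projective module `P`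
(given by a dual basis) satisfies `dim Hom(P, Q) = dim Hom(Q, P)`. -/
theorem finrank_linearMap_comm_of_symmetric [Module.Finite k A] (t : A →ₗ[k] k)
    (symm : ∀ a b, t (a * b) = t (b * a)) (nd : ∀ a, (∀ b, t (b * a) = 0) → a = 0)
    {P Q : Type*}
    [AddCommGroup P] [Module k P] [Module A P] [IsScalarTower k A P] [Module.Finite k P]
    [AddCommGroup Q] [Module k Q] [Module A Q] [IsScalarTower k A Q] [Module.Finite k Q]
    {ι : Type*} [Fintype ι] (p : ι → P) (φ : ι → P →ₗ[A] A) (hp : ∀ x, ∑ i, φ i x • p i = x) :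
    Module.finrank k (P →ₗ[A] Q) = Module.finrank k (Q →ₗ[A] P) := by
  have := Module.Finite.linearMap_of_algebra (k := k) (A := A) P Q
  have := Module.Finite.linearMap_of_algebra (k := k) (A := A) Q P
  -- `B f g` is the trace of `g ∘ f`, computed in the dual basis and followed by `t`. It is shown to
  -- be a perfect pairing.
  let B : (P →ₗ[A] Q) →ₗ[k] (Q →ₗ[A] P) →ₗ[k] k :=
    LinearMap.mk₂ k (fun f g => ∑ i, t (φ i (g (f (p i)))))
      (fun _ _ _ => by simp [Finset.sum_add_distrib])
      (fun c f g => by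
        simp only [LinearMap.smul_apply, LinearMap.map_smul_of_tower, Finset.smul_sum])
      (fun _ _ _ => by simp [Finset.sum_add_distrib])
      (fun c f g => by
        simp only [LinearMap.smul_apply, LinearMap.map_smul_of_tower, Finset.smul_sum])
  have hB (f : P →ₗ[A] Q) (g : Q →ₗ[A] P) : B f g = ∑ i, t (φ i (g (f (p i)))) := rfl
  have ext_p {f : P →ₗ[A] Q} (h : ∀ j, f (p j) = 0) : f = 0 := by
    ext x
    rw [← hp x]
    simp [h]
  -- By symmetry of `t`, the left side is the trace of the endomorphism `x ↦ ψ x • y`; all the test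
  -- maps below have this shape.
  have key (y : P) (ψ : P →ₗ[A] A) : ∑ i, t (φ i y * ψ (p i)) = t (ψ y) := by
    conv_rhs => rw [← hp y]
    simp
  have injl : Function.Injective B := by
    rw [injective_iff_map_eq_zero]
    refine fun f hf => ext_p fun j => ?_
    refine (Module.forall_dual_apply_eq_zero_iff k _).1 fun l => ?_
    obtain ⟨ψ, hψ⟩ := exists_linearMap_of_nondegenerate t nd l
    -- Pairing `f` with this map returns `l (f (p j))`, for an arbitrary functional `l`.
    have h0 : B f (ψ.smulRight (p j)) = 0 := by rw [hf]; rfl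
    rw [← hψ, ← LinearMap.comp_apply, ← key, ← h0, hB]
    refine Finset.sum_congr rfl fun i _ => ?_
    rw [symm]
    simp
  have injr : Function.Injective B.flip := by
    rw [injective_iff_map_eq_zero]
    intro g hg
    ext q
    rw [LinearMap.zero_apply, ← hp (g q)]
    refine Finset.sum_eq_zero fun j _ => ?_
    rw [nd (φ j (g q)) fun b => ?_, zero_smul]
    have h0 : B ((φ j).smulRight (b • q)) g = 0 := by
      rw [← LinearMap.flip_apply, hg]; rfl
    rw [← smul_eq_mul, ← map_smul, ← map_smul, ← key, ← h0, hB]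
    refine Finset.sum_congr rfl fun i _ => ?_
    rw [symm]
    simp
  have := LinearMap.IsPerfPair.of_injective injl injr
  exact Module.finrank_of_isPerfPair B

end ModuleTheory

/-! ### Semisimple modules, tops and socles. -/

section Semisimple

variable {k A : Type*} [Field k] [Ring A] [Algebra k A]

/-- By Schur's lemma both sides vanish unless the modules are isomorphic. It reconciles
multiplicities counted by maps to a simple module with those counted by maps from it. -/
theorem finrank_linearMap_comm_of_isSimpleModule (S T : Type*)
    [AddCommGroup S] [Module k S] [Module A S] [IsScalarTower k A S]
    [AddCommGroup T] [Module k T] [Module A T] [IsScalarTower k A T]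
    [IsSimpleModule A S] [IsSimpleModule A T] :
    Module.finrank k (S →ₗ[A] T) = Module.finrank k (T →ₗ[A] S) := by
  by_cases h : Nonempty (S ≃ₗ[A] T)
  · obtain ⟨e⟩ := h
    exact LinearEquiv.finrank_eq
      ({ toFun := fun f => e.symm.toLinearMap ∘ₗ f ∘ₗ e.symm.toLinearMap
         invFun := fun f => e.toLinearMap ∘ₗ f ∘ₗ e.toLinearMap
         map_add' := fun f g => by ext; simp
         map_smul' := fun c f => LinearMap.ext fun x =>
          e.symm.toLinearMap.map_smul_of_tower c (f (e.symm x))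
         left_inv := fun f => by ext; simp
         right_inv := fun f => by ext; simp } : (S →ₗ[A] T) ≃ₗ[k] (T →ₗ[A] S))
  · have h1 : Subsingleton (S →ₗ[A] T) := subsingleton_of_forall_eq 0 fun f => by
      by_contra hf
      exact h ⟨LinearEquiv.ofBijective f (LinearMap.bijective_of_ne_zero hf)⟩
    have h2 : Subsingleton (T →ₗ[A] S) := subsingleton_of_forall_eq 0 fun f => by
      by_contra hf
      exact h ⟨(LinearEquiv.ofBijective f (LinearMap.bijective_of_ne_zero hf)).symm⟩
    rw [Module.finrank_zero_of_subsingleton, Module.finrank_zero_of_subsingleton]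

theorem finrank_linearMap_isCompl_left {U : Type*} (T : Type*)
    [AddCommGroup U] [Module k U] [Module A U] [IsScalarTower k A U] [Module.Finite k U]
    [AddCommGroup T] [Module k T] [Module A T] [IsScalarTower k A T] [Module.Finite k T]
    {S S' : Submodule A U} (h : IsCompl S S') :
    Module.finrank k (U →ₗ[A] T) =
      Module.finrank k (S →ₗ[A] T) + Module.finrank k (S' →ₗ[A] T) := by
  have : Module.Finite k S := Module.Finite.of_injective (S.subtype.restrictScalars k)
    S.injective_subtype
  have : Module.Finite k S' := Module.Finite.of_injective (S'.subtype.restrictScalars k)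
    S'.injective_subtype
  have := Module.Finite.linearMap_of_algebra (k := k) (A := A) S T
  have := Module.Finite.linearMap_of_algebra (k := k) (A := A) S' T
  rw [← Module.finrank_prod]
  let e := S.prodEquivOfIsCompl S' h
  exact LinearEquiv.finrank_eq
    ({ toFun := fun f => (f ∘ₗ S.subtype, f ∘ₗ S'.subtype)
       invFun := fun p => p.1.coprod p.2 ∘ₗ e.symm.toLinearMap
       map_add' := fun f g => rfl
       map_smul' := fun c f => rfl
       left_inv := fun f => by
        ext x
        obtain ⟨y, rfl⟩ := e.surjective x
        simp [e]
       right_inv := fun p => by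
        ext x <;> simp [e] } : (U →ₗ[A] T) ≃ₗ[k] (S →ₗ[A] T) × (S' →ₗ[A] T))

theorem finrank_linearMap_isCompl_right {U : Type*} (T : Type*)
    [AddCommGroup U] [Module k U] [Module A U] [IsScalarTower k A U] [Module.Finite k U]
    [AddCommGroup T] [Module k T] [Module A T] [IsScalarTower k A T] [Module.Finite k T]
    {S S' : Submodule A U} (h : IsCompl S S') :
    Module.finrank k (T →ₗ[A] U) =
      Module.finrank k (T →ₗ[A] S) + Module.finrank k (T →ₗ[A] S') := by
  have : Module.Finite k S := Module.Finite.of_injective (S.subtype.restrictScalars k)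
    S.injective_subtype
  have : Module.Finite k S' := Module.Finite.of_injective (S'.subtype.restrictScalars k)
    S'.injective_subtype
  have := Module.Finite.linearMap_of_algebra (k := k) (A := A) T S
  have := Module.Finite.linearMap_of_algebra (k := k) (A := A) T S'
  rw [← Module.finrank_prod]
  let e := S.prodEquivOfIsCompl S' h
  exact LinearEquiv.finrank_eq
    ({ toFun := fun f => (LinearMap.fst A S S' ∘ₗ e.symm.toLinearMap ∘ₗ f,
         LinearMap.snd A S S' ∘ₗ e.symm.toLinearMap ∘ₗ f)
       invFun := fun p => e.toLinearMap ∘ₗ p.1.prod p.2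
       map_add' := fun f g => by ext <;> simp
       map_smul' := fun c f => by
        have hx (x : T) := e.symm.toLinearMap.map_smul_of_tower c (f x)
        exact Prod.ext (LinearMap.ext fun x => congrArg Prod.fst (hx x))
          (LinearMap.ext fun x => congrArg Prod.snd (hx x))
       left_inv := fun f => by
        ext x
        simp
       right_inv := fun p => by
        ext x <;> simp } : (T →ₗ[A] U) ≃ₗ[k] (T →ₗ[A] S) × (T →ₗ[A] S'))

/-- Two finite-dimensional semisimple modules with the same multiplicities are isomorphic. -/
theorem nonempty_linearEquiv_of_finrank_linearMap_eq (n : ℕ) (U V : Type u)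
    [AddCommGroup U] [Module k U] [Module A U] [IsScalarTower k A U] [Module.Finite k U]
    [AddCommGroup V] [Module k V] [Module A V] [IsScalarTower k A V] [Module.Finite k V]
    [IsSemisimpleModule A U] [IsSemisimpleModule A V] (hn : Module.finrank k U = n)
    (H : ∀ (S : Type u) [AddCommGroup S] [Module k S] [Module A S] [IsScalarTower k A S]
      [Module.Finite k S] [IsSimpleModule A S],
      Module.finrank k (U →ₗ[A] S) = Module.finrank k (S →ₗ[A] V)) :
    Nonempty (U ≃ₗ[A] V) := by
  induction n using Nat.strong_induction_on generalizing U V with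
  | _ n ih =>
  rcases subsingleton_or_nontrivial U with hU | hU
  · have hV : Subsingleton V := by
      by_contra hV
      rw [not_subsingleton_iff_nontrivial] at hV
      obtain ⟨S, hS⟩ := IsSemisimpleModule.exists_simple_submodule A V
      have : Module.Finite k S := Module.Finite.of_injective (S.subtype.restrictScalars k)
        S.injective_subtype
      have := Module.Finite.linearMap_of_algebra (k := k) (A := A) S V
      have h1 := H S
      rw [Module.finrank_zero_of_subsingleton] at h1
      have h2 := Module.finrank_zero_iff.1 h1.symm
      have h3 : S.subtype = 0 := Subsingleton.elim _ _
      have := IsSimpleModule.nontrivial A S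
      obtain ⟨x, hx⟩ := exists_ne (0 : S)
      exact hx (Subtype.ext (LinearMap.congr_fun h3 x))
    exact ⟨LinearEquiv.ofSubsingleton U V⟩
  · obtain ⟨S, hS⟩ := IsSemisimpleModule.exists_simple_submodule A U
    obtain ⟨S', hS'⟩ := exists_isCompl S
    have : Module.Finite k S := Module.Finite.of_injective (S.subtype.restrictScalars k)
      S.injective_subtype
    have : Module.Finite k S' := Module.Finite.of_injective (S'.subtype.restrictScalars k)
      S'.injective_subtype
    have fUS := Module.Finite.linearMap_of_algebra (k := k) (A := A) U S
    have fSV := Module.Finite.linearMap_of_algebra (k := k) (A := A) S V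
    have nS := IsSimpleModule.nontrivial A S
    -- The summand `S` of `U` gives a nonzero map `U → S`, so by `H` a copy of `S` also lies in `V`.
    -- Splitting off both copies reduces the dimension.
    have hne : Nontrivial (S →ₗ[A] V) := by
      have : Nontrivial (U →ₗ[A] S) := by
        refine ⟨S.projectionOnto S' hS', 0, fun h0 => ?_⟩
        obtain ⟨x, hx⟩ := exists_ne (0 : S)
        have := LinearMap.congr_fun h0 x
        rw [Submodule.projectionOnto_apply_left, LinearMap.zero_apply] at this
        exact hx this
      rw [← Module.finrank_pos_iff (R := k), ← H S]
      exact Module.finrank_pos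
    obtain ⟨f, hf⟩ := exists_ne (0 : S →ₗ[A] V)
    have injf := LinearMap.injective_of_ne_zero hf
    let W := LinearMap.range f
    let eW : S ≃ₗ[A] W := LinearEquiv.ofInjective f injf
    have : IsSimpleModule A W := IsSimpleModule.congr eW.symm
    obtain ⟨W', hW'⟩ := exists_isCompl W
    have : Module.Finite k W := Module.Finite.of_injective (W.subtype.restrictScalars k)
      W.injective_subtype
    have : Module.Finite k W' := Module.Finite.of_injective (W'.subtype.restrictScalars k)
      W'.injective_subtype
    have hlt : Module.finrank k S' < n := by
      have h1 := (((S.prodEquivOfIsCompl S' hS').restrictScalars k).finrank_eq)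
      rw [Module.finrank_prod] at h1
      have : 0 < Module.finrank k S := Module.finrank_pos
      omega
    obtain ⟨e'⟩ := ih _ hlt S' W' rfl fun T _ _ _ _ _ _ => by
      have h1 := H T
      rw [finrank_linearMap_isCompl_left T hS', finrank_linearMap_isCompl_right T hW'] at h1
      have h2 : Module.finrank k (S →ₗ[A] T) = Module.finrank k (T →ₗ[A] W) := by
        rw [finrank_linearMap_comm_of_isSimpleModule T W]
        exact LinearEquiv.finrank_eq
          ({ toFun := fun f => f ∘ₗ eW.symm.toLinearMap
             invFun := fun f => f ∘ₗ eW.toLinearMap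
             map_add' := fun f g => by ext; simp
             map_smul' := fun c f => by ext; simp
             left_inv := fun f => by ext; simp
             right_inv := fun f => by ext; simp } : (S →ₗ[A] T) ≃ₗ[k] (W →ₗ[A] T))
      omega
    exact ⟨(S.prodEquivOfIsCompl S' hS').symm ≪≫ₗ (eW.prodCongr e') ≪≫ₗ
      W.prodEquivOfIsCompl W' hW'⟩

/-- If `dim Hom(P, S) = dim Hom(S, P)` for all simple modules `S`, then the top and the socle
of `P` are isomorphic. -/
theorem nonempty_linearEquiv_quotient_jacobson_socle (P : Type u)
    [AddCommGroup P] [Module k P] [Module A P] [IsScalarTower k A P] [Module.Finite k P]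
    (H : ∀ (S : Type u) [AddCommGroup S] [Module k S] [Module A S] [IsScalarTower k A S]
      [Module.Finite k S] [IsSimpleModule A S],
      Module.finrank k (P →ₗ[A] S) = Module.finrank k (S →ₗ[A] P)) :
    Nonempty ((P ⧸ Module.jacobson A P) ≃ₗ[A]
      (sSup {S : Submodule A P | IsAtom S} : Submodule A P)) := by
  set V := sSup {S : Submodule A P | IsAtom S} with hV
  set J := Module.jacobson A P with hJ
  have : Module.Finite k V := Module.Finite.of_injective (V.subtype.restrictScalars k)
      V.injective_subtype
  have : Module.Finite k (P ⧸ J) := Module.Finite.of_surjective (J.mkQ.restrictScalars k)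
      J.mkQ_surjective
  have : IsArtinian A (P ⧸ J) := isArtinian_of_tower k inferInstance
  have : IsSemisimpleModule A (P ⧸ J) :=
    (IsArtinian.isSemisimpleModule_iff_jacobson A _).2 (Module.jacobson_quotient_jacobson A P)
  have : IsSemisimpleModule A V := by
    rw [hV, sSup_eq_iSup]
    refine isSemisimpleModule_biSup_of_isSemisimpleModule_submodule fun S hS => ?_
    have : IsSimpleModule A S := isSimpleModule_iff_isAtom.2 hS
    infer_instance
  refine nonempty_linearEquiv_of_finrank_linearMap_eq (k := k) _ _ _ rfl
    fun S _ _ _ _ _ _ => ?_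
  -- Maps to a simple module kill the radical and maps from one land in the socle, so `H` for `P` is
  -- the multiplicity hypothesis for the top and the socle.
  have hJS (f : P →ₗ[A] S) : J ≤ LinearMap.ker f := by
    intro x hx
    by_contra hne
    have hf : f ≠ 0 := by rintro rfl; simp at hne
    have hco : IsCoatom (LinearMap.ker f) := by
      rw [← isSimpleModule_iff_isCoatom]
      exact IsSimpleModule.congr
        (f.quotKerEquivOfSurjective (LinearMap.surjective_of_ne_zero hf))
    exact hne ((sInf_le hco : J ≤ _) hx)
  have hSV (f : S →ₗ[A] P) (x : S) : f x ∈ V := by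
    by_cases hf : f = 0
    · simp [hf]
    · have : IsSimpleModule A (LinearMap.range f) := IsSimpleModule.congr
        (LinearEquiv.ofInjective f (LinearMap.injective_of_ne_zero hf)).symm
      exact (le_sSup (isSimpleModule_iff_isAtom.1 this) : _ ≤ V) (LinearMap.mem_range_self f x)
  have e1 : ((P ⧸ J) →ₗ[A] S) ≃ₗ[k] (P →ₗ[A] S) :=
    { toFun := fun f => f ∘ₗ J.mkQ
      invFun := fun f => J.liftQ f (hJS f)
      map_add' := fun f g => rfl
      map_smul' := fun c f => rfl
      left_inv := fun f => by ext; simp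
      right_inv := fun f => by ext; simp }
  have e2 : (S →ₗ[A] V) ≃ₗ[k] (S →ₗ[A] P) :=
    { toFun := fun f => V.subtype ∘ₗ f
      invFun := fun f => f.codRestrict V (hSV f)
      map_add' := fun f g => rfl
      map_smul' := fun c f => rfl
      left_inv := fun f => by ext; simp
      right_inv := fun f => by ext; simp }
  rw [e1.finrank_eq, e2.finrank_eq, H S]

end Semisimple

/-! ### The trace form on correspondences. -/

namespace FinCorr

instance (X Y : FinCorr.{u}) : Finite (X ⟶ Y) :=
  Finite.of_injective (fun R : Hom X Y => R.graph) fun _ _ h => Hom.ext h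

/-- The opposite correspondence. -/
def opposite (X Y : FinCorr.{u}) : (X ⟶ Y) ≃ (Y ⟶ X) where
  toFun R := ⟨{p | p.swap ∈ (show Hom X Y from R).graph}⟩
  invFun R := ⟨{p | p.swap ∈ (show Hom Y X from R).graph}⟩
  left_inv _ := rfl
  right_inv _ := rfl

/-- Whether a correspondence from `E` to itself meets the diagonal. -/
def MeetsDiagonal {E : FinCorr.{u}} (R : E ⟶ E) : Prop :=
  ∃ e, (e, e) ∈ (show Hom E E from R).graph

theorem meetsDiagonal_comp {E X : FinCorr.{u}} (R : E ⟶ X) (S : X ⟶ E) :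
    MeetsDiagonal (R ≫ S) ↔
      ∃ e x, (e, x) ∈ (show Hom X E from S).graph ∧ (x, e) ∈ (show Hom E X from R).graph :=
  Iff.rfl

/-- Both conditions say that one correspondence meets the opposite of the other. This is the source
of the symmetry of the trace form. -/
theorem meetsDiagonal_comp_comm {E X : FinCorr.{u}} (R : E ⟶ X) (S : X ⟶ E) :
    MeetsDiagonal (R ≫ S) ↔ MeetsDiagonal (S ≫ R) := by
  rw [meetsDiagonal_comp, meetsDiagonal_comp, exists_comm]
  simp only [and_comm]

section Trace

variable {k : Type u} [Field k]

/-- Composition with a correspondence, extended linearly. -/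
noncomputable def post {E X Y : FinCorr.{u}} (S : X ⟶ Y) :
    MonoidAlgebra k (E ⟶ X) →ₗ[k] MonoidAlgebra k (E ⟶ Y) :=
  MonoidAlgebra.mapDomainLinearMap k k fun R => R ≫ S

@[simp]
theorem post_single {E X Y : FinCorr.{u}} (S : X ⟶ Y) (R : E ⟶ X) (c : k) :
    post S (MonoidAlgebra.single R c) = MonoidAlgebra.single (R ≫ S) c :=
  MonoidAlgebra.mapDomainLinearMap_single _ _ _

theorem linearMap_ext {E X : FinCorr.{u}} {V : Type*} [AddCommMonoid V] [Module k V]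
    {f g : MonoidAlgebra k (E ⟶ X) →ₗ[k] V}
    (h : ∀ R, f (MonoidAlgebra.single R 1) = g (MonoidAlgebra.single R 1)) : f = g :=
  (MonoidAlgebra.basis (E ⟶ X) k).ext fun R => by simpa using h R

theorem post_comp {E X Y Z : FinCorr.{u}} (S : X ⟶ Y) (T : Y ⟶ Z) (a : MonoidAlgebra k (E ⟶ X)) :
    post (S ≫ T) a = post T (post S a) :=
  LinearMap.congr_fun (linearMap_ext (g := post T ∘ₗ post S) fun R => by simp) a

theorem post_id {E X : FinCorr.{u}} (a : MonoidAlgebra k (E ⟶ X)) : post (𝟙 X) a = a :=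
  LinearMap.congr_fun (linearMap_ext (g := LinearMap.id) fun R => by simp) a

theorem single_mul_eq_post {E : FinCorr.{u}} (S : End E) (a : MonoidAlgebra k (End E)) :
    MonoidAlgebra.single S (1 : k) * a = post (E := E) (X := E) (Y := E) S a :=
  LinearMap.congr_fun (f := LinearMap.mulLeft k (MonoidAlgebra.single S (1 : k)))
    (linearMap_ext (g := post (E := E) (X := E) (Y := E) S) fun R => by
      rw [post_single, LinearMap.mulLeft_apply]
      exact (MonoidAlgebra.single_mul_single ..).trans (by rw [one_mul]; rfl)) a

open Classical in
/-- The linear form sending a correspondence to `1` if it is disjoint from the diagonal, and to `0`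
otherwise. -/
noncomputable def trace (E : FinCorr.{u}) : MonoidAlgebra k (E ⟶ E) →ₗ[k] k :=
  (MonoidAlgebra.basis (E ⟶ E) k).constr k fun R => if MeetsDiagonal R then 0 else 1

open Classical in
theorem trace_single {E : FinCorr.{u}} (R : E ⟶ E) :
    trace E (MonoidAlgebra.single R (1 : k)) = if MeetsDiagonal R then 0 else 1 := by
  have := (MonoidAlgebra.basis (E ⟶ E) k).constr_basis k
    (fun R => if MeetsDiagonal R then (0 : k) else 1) R
  rwa [MonoidAlgebra.basis_apply] at this

theorem trace_mul_comm {E : FinCorr.{u}} (a b : MonoidAlgebra k (End E)) :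
    trace E (a * b) = trace E (b * a) := by
  classical
  let t : MonoidAlgebra k (End E) →ₗ[k] k := trace E
  change t (a * b) = t (b * a)
  induction a using MonoidAlgebra.induction_on with
  | add x y hx hy => rw [add_mul, mul_add, map_add, map_add, hx, hy]
  | smul r x hx => rw [smul_mul_assoc, mul_smul_comm, map_smul, map_smul, hx]
  | of R =>
    induction b using MonoidAlgebra.induction_on with
    | add x y hx hy => rw [add_mul, mul_add, map_add, map_add, hx, hy]
    | smul r x hx => rw [smul_mul_assoc, mul_smul_comm, map_smul, map_smul, hx]
    | of S =>
      rw [← map_mul, ← map_mul]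
      refine (trace_single _).trans (Eq.trans ?_ (trace_single _).symm)
      have := meetsDiagonal_comp_comm (E := E) (X := E) S R
      exact if_congr this rfl rfl

/-- Pairing with complements of opposites gives the incidence matrix of inclusion, which is
unitriangular. The case `X = E` is nondegeneracy on the algebra; general `X` yields detection at
`E`. -/
theorem eq_zero_of_trace_post_eq_zero {E X : FinCorr.{u}} (a : MonoidAlgebra k (E ⟶ X))
    (h : ∀ S : X ⟶ E, trace E (post S a) = 0) : a = 0 := by
  classical
  by_contra ha
  have hne : a.coeff.support.Nonempty := by
    rw [Finsupp.support_nonempty_iff]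
    simpa using ha
  obtain ⟨R, hR, hmin⟩ := a.coeff.support.finite_toSet.exists_minimalFor
    (fun R : E ⟶ X => (show Hom E X from R).graph) _ hne
  -- With this `S`, the trace of `Q ≫ S` is 1 exactly when `Q ⊆ R`. Minimality of `R` in the support
  -- leaves only the coefficient of `R`.
  let S : X ⟶ E := ⟨{p | p.swap ∉ (show Hom E X from R).graph}⟩
  have hS (Q : E ⟶ X) : MeetsDiagonal (Q ≫ S) ↔
      ¬ (show Hom E X from Q).graph ⊆ (show Hom E X from R).graph := by
    rw [meetsDiagonal_comp, Set.not_subset]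
    constructor
    · rintro ⟨e, x, h1, h2⟩
      exact ⟨(x, e), h2, h1⟩
    · rintro ⟨⟨x, e⟩, h2, h1⟩
      exact ⟨e, x, h1, h2⟩
  have hsum : trace E (post S a) = ∑ Q ∈ a.coeff.support, a.coeff Q *
      trace E (post S (MonoidAlgebra.single Q (1 : k))) := by
    have h1 := (MonoidAlgebra.basis (E ⟶ X) k).linearCombination_repr a
    rw [Finsupp.linearCombination_apply, Finsupp.sum] at h1
    conv_lhs => rw [← h1]
    simp only [map_sum, map_smul, MonoidAlgebra.basis_apply, smul_eq_mul]
    rfl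
  rw [h, Finset.sum_eq_single R] at hsum
  · rw [post_single, trace_single, if_neg (by rw [hS]; simp), mul_one] at hsum
    exact (Finsupp.mem_support_iff.1 hR) hsum.symm
  · intro Q hQ hQR
    rw [post_single, trace_single, if_pos, mul_zero]
    rw [hS]
    intro hle
    exact hQR (Hom.ext (le_antisymm hle (hmin hQ hle)))
  · exact fun hn => absurd hR hn

/-- Injectivity gives surjectivity because taking opposites equates the dimensions. It allows
elements of kC(E, X) to be defined by prescribing their pairings. -/
theorem exists_trace_post_eq {E X : FinCorr.{u}} (l : (X ⟶ E) → k) :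
    ∃ a : MonoidAlgebra k (E ⟶ X), ∀ S : X ⟶ E, trace E (post S a) = l S := by
  let D : MonoidAlgebra k (E ⟶ X) →ₗ[k] ((X ⟶ E) → k) :=
    LinearMap.pi fun S => trace E ∘ₗ post S
  have : Fintype (E ⟶ X) := Fintype.ofFinite _
  have : Fintype (X ⟶ E) := Fintype.ofFinite _
  have : Module.Finite k (MonoidAlgebra k (E ⟶ X)) :=
    Module.Finite.of_basis (MonoidAlgebra.basis (E ⟶ X) k)
  have hrank : Module.finrank k (MonoidAlgebra k (E ⟶ X)) = Module.finrank k ((X ⟶ E) → k) := by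
    rw [Module.finrank_eq_card_basis (MonoidAlgebra.basis (E ⟶ X) k),
      Module.finrank_fintype_fun_eq_card]
    exact Fintype.card_congr (opposite E X)
  have inj : Function.Injective D := by
    rw [injective_iff_map_eq_zero]
    exact fun a ha => eq_zero_of_trace_post_eq_zero a fun S => congrFun ha S
  obtain ⟨a, ha⟩ := (LinearMap.injective_iff_surjective_of_finrank_eq_finrank hrank).1 inj l
  exact ⟨a, fun S => congrFun ha S⟩

end Trace

end FinCorr

/-! ### Evaluation at a finite set and dual bases. -/

namespace CorrFunctor

open FinCorr

variable {k : Type u} [Field k]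

theorem map_comp_apply (M : CorrFunctor k) {X Y Z : FinCorr.{u}} (S : X ⟶ Y) (T : Y ⟶ Z)
    (x : M.obj X) : (M.map (S ≫ T)).hom x = (M.map T).hom ((M.map S).hom x) := by
  simp

theorem map_id_apply (M : CorrFunctor k) {X : FinCorr.{u}} (x : M.obj X) :
    (M.map (𝟙 X)).hom x = x := by
  simp

theorem naturality_apply {M N : CorrFunctor k} (f : M ⟶ N) {X Y : FinCorr.{u}} (S : X ⟶ Y)
    (x : M.obj X) : (f.app Y).hom ((M.map S).hom x) = (N.map S).hom ((f.app X).hom x) := by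
  simp

theorem hom_ext_apply {M N : CorrFunctor k} {f g : M ⟶ N}
    (h : ∀ (X : FinCorr.{u}) (x : M.obj X), (f.app X).hom x = (g.app X).hom x) : f = g := by
  ext X x
  exact h X x

/-- A natural transformation given by its values. -/
def homMk {M N : CorrFunctor k} (f : ∀ X, M.obj X →ₗ[k] N.obj X)
    (nat : ∀ {X Y : FinCorr.{u}} (S : X ⟶ Y) (x : M.obj X),
      f Y ((M.map S).hom x) = (N.map S).hom (f X x)) : M ⟶ N where
  app X := ModuleCat.ofHom (f X)
  naturality X Y S := by
    ext x
    exact nat S x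

/-- The linear action of linear combinations of correspondences on an element of `M E`. -/
noncomputable def act (M : CorrFunctor k) {E : FinCorr.{u}} (m : M.obj E) (X : FinCorr.{u}) :
    MonoidAlgebra k (E ⟶ X) →ₗ[k] M.obj X :=
  (MonoidAlgebra.basis (E ⟶ X) k).constr k fun S => (M.map S).hom m

@[simp]
theorem act_single (M : CorrFunctor k) {E X : FinCorr.{u}} (m : M.obj E) (S : E ⟶ X) :
    M.act m X (MonoidAlgebra.single S 1) = (M.map S).hom m := by
  have := (MonoidAlgebra.basis (E ⟶ X) k).constr_basis k (fun S => (M.map S).hom m) S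
  rwa [MonoidAlgebra.basis_apply] at this

theorem act_post (M : CorrFunctor k) {E X Y : FinCorr.{u}} (m : M.obj E) (S : X ⟶ Y)
    (a : MonoidAlgebra k (E ⟶ X)) : M.act m Y (post S a) = (M.map S).hom (M.act m X a) :=
  LinearMap.congr_fun (f := M.act m Y ∘ₗ post S) (g := (M.map S).hom ∘ₗ M.act m X)
    (linearMap_ext fun R => by simp) a

theorem app_act {M N : CorrFunctor k} (f : M ⟶ N) {E X : FinCorr.{u}} (m : M.obj E)
    (a : MonoidAlgebra k (E ⟶ X)) :
    (f.app X).hom (M.act m X a) = N.act ((f.app E).hom m) X a :=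
  LinearMap.congr_fun (f := (f.app X).hom ∘ₗ M.act m X) (g := N.act ((f.app E).hom m) X)
    (linearMap_ext fun R => by
      rw [LinearMap.comp_apply, act_single, act_single, naturality_apply]) a

/-- The representation of the monoid of endomorphisms of `E` on `M E`. -/
def rep (M : CorrFunctor k) (E : FinCorr.{u}) : Representation k (End E) (M.obj E) where
  toFun R := (M.map R).hom
  map_one' := LinearMap.ext fun x => M.map_id_apply x
  map_mul' R S := LinearMap.ext fun x => M.map_comp_apply S R x

/-- The vector space `M E` is a module over the algebra of correspondences on `E`. -/
noncomputable instance moduleObj (M : CorrFunctor k) (E : FinCorr.{u}) :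
    Module (MonoidAlgebra k (End E)) (M.obj E) :=
  Module.compHom (M.obj E) (M.rep E).asAlgebraHom.toRingHom

theorem smul_obj_def (M : CorrFunctor k) {E : FinCorr.{u}} (a : MonoidAlgebra k (End E))
    (x : M.obj E) : a • x = (M.rep E).asAlgebraHom a x := rfl

instance (M : CorrFunctor k) (E : FinCorr.{u}) :
    IsScalarTower k (MonoidAlgebra k (End E)) (M.obj E) where
  smul_assoc c a x := by
    rw [smul_obj_def, smul_obj_def, map_smul, LinearMap.smul_apply]

theorem single_smul_obj (M : CorrFunctor k) {E : FinCorr.{u}} (R : End E) (x : M.obj E) :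
    MonoidAlgebra.single R (1 : k) • x = (M.map R).hom x := by
  rw [smul_obj_def, Representation.asAlgebraHom_single, one_smul]
  rfl

theorem act_eq_smul (M : CorrFunctor k) {E : FinCorr.{u}} (a : MonoidAlgebra k (End E))
    (x : M.obj E) : M.act x E a = a • x :=
  LinearMap.congr_fun (f := M.act x E)
    (g := (LinearMap.toSpanSingleton (MonoidAlgebra k (End E)) (M.obj E) x).restrictScalars k)
    (linearMap_ext fun R => by
      rw [act_single]
      exact (M.single_smul_obj R x).symm) a

/-- A linear map on `M E` commuting with correspondences is a module homomorphism. -/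
noncomputable def objHom {M N : CorrFunctor k} {E : FinCorr.{u}} (g : M.obj E →ₗ[k] N.obj E)
    (h : ∀ (R : E ⟶ E) (x : M.obj E), g ((M.map R).hom x) = (N.map R).hom (g x)) :
    M.obj E →ₗ[MonoidAlgebra k (End E)] N.obj E :=
  MonoidAlgebra.equivariantOfLinearOfComm (V := M.obj E) (W := N.obj E) g fun R x => by
    rw [single_smul_obj, single_smul_obj, h]

theorem objHom_map {M N : CorrFunctor k} {E : FinCorr.{u}}
    (g : M.obj E →ₗ[MonoidAlgebra k (End E)] N.obj E) (R : E ⟶ E) (x : M.obj E) :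
    g ((M.map R).hom x) = (N.map R).hom (g x) := by
  have := g.map_smul (MonoidAlgebra.single (show End E from R) (1 : k)) x
  rwa [single_smul_obj, single_smul_obj] at this

/-- Evaluation of natural transformations at `E`. -/
noncomputable def evalHom (M N : CorrFunctor k) (E : FinCorr.{u}) :
    (M ⟶ N) →ₗ[k] (M.obj E →ₗ[MonoidAlgebra k (End E)] N.obj E) where
  toFun f := objHom (f.app E).hom fun R x => naturality_apply f R x
  map_add' _ _ := rfl
  map_smul' _ _ := rfl

theorem evalHom_apply {M N : CorrFunctor k} {E : FinCorr.{u}} (f : M ⟶ N) (x : M.obj E) :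
    evalHom M N E f x = (f.app E).hom x := rfl

/-- A dual basis of `M` at `E`: this exhibits `M` as a direct summand of a finite direct sum of
copies of the functor represented by `E`. -/
structure DualBasis (M : CorrFunctor k) (E : FinCorr.{u}) where
  /-- The number of elements. -/
  n : ℕ
  /-- The generators. -/
  elt : Fin n → M.obj E
  /-- The coordinates. -/
  coord : Fin n → ∀ X, M.obj X →ₗ[k] MonoidAlgebra k (E ⟶ X)
  coord_map : ∀ (i : Fin n) {X Y : FinCorr.{u}} (S : X ⟶ Y) (x : M.obj X),
    coord i Y ((M.map S).hom x) = post S (coord i X x)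
  sum_act : ∀ (X : FinCorr.{u}) (x : M.obj X), ∑ i, M.act (elt i) X (coord i X x) = x

namespace DualBasis

variable {M : CorrFunctor k} {E : FinCorr.{u}} (b : DualBasis M E)
include b

/-- The coordinates at `E`, as module homomorphisms. -/
noncomputable def objCoord (i : Fin b.n) :
    M.obj E →ₗ[MonoidAlgebra k (End E)] MonoidAlgebra k (End E) :=
  MonoidAlgebra.equivariantOfLinearOfComm (V := M.obj E) (W := MonoidAlgebra k (End E))
    (b.coord i E) fun R x => by
      refine (congrArg (b.coord i E) (M.single_smul_obj R x)).trans
        ((b.coord_map i (X := E) (Y := E) R x).trans ?_)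
      exact (single_mul_eq_post R _).symm

theorem finrank_objHom_comm {Q : Type*} [AddCommGroup Q] [Module k Q]
    [Module (MonoidAlgebra k (End E)) Q] [IsScalarTower k (MonoidAlgebra k (End E)) Q]
    [Module.Finite k Q] [Module.Finite k (M.obj E)] :
    Module.finrank k (M.obj E →ₗ[MonoidAlgebra k (End E)] Q) =
      Module.finrank k (Q →ₗ[MonoidAlgebra k (End E)] M.obj E) := by
  have : Finite (End E) := inferInstanceAs (Finite (E ⟶ E))
  have : Module.Finite k (MonoidAlgebra k (End E)) :=
    Module.Finite.of_basis (MonoidAlgebra.basis (End E) k)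
  refine finrank_linearMap_comm_of_symmetric (trace E : MonoidAlgebra k (End E) →ₗ[k] k)
    trace_mul_comm (fun a ha => ?_) (P := M.obj E) b.elt b.objCoord fun x => ?_
  · refine eq_zero_of_trace_post_eq_zero a fun S => ?_
    rw [← single_mul_eq_post]
    exact ha _
  · refine Eq.trans (Finset.sum_congr rfl fun i _ => ?_) (b.sum_act E x)
    exact (M.act_eq_smul (b.objCoord i x) (b.elt i)).symm

/-- The coordinates of `x` lie in kC(E, X), where the trace pairing detects zero. -/
theorem eq_zero_of_map_eq_zero {X : FinCorr.{u}} (x : M.obj X)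
    (h : ∀ S : X ⟶ E, (M.map S).hom x = 0) : x = 0 := by
  rw [← b.sum_act X x]
  refine Finset.sum_eq_zero fun i _ => ?_
  rw [eq_zero_of_trace_post_eq_zero (b.coord i X x) fun S => ?_, map_zero]
  rw [← b.coord_map, h, map_zero, map_zero]

/-- Yoneda for a summand of copies of kC(E, -): a map is determined by the images of the elements
`b.elt i`. -/
theorem bijective_evalHom_left (N : CorrFunctor k) : Function.Bijective (evalHom M N E) := by
  constructor
  · rw [injective_iff_map_eq_zero]
    intro f hf
    refine hom_ext_apply fun X x => ?_
    rw [← b.sum_act X x, map_sum, map_sum]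
    refine Finset.sum_congr rfl fun i _ => ?_
    rw [app_act, app_act, ← evalHom_apply, hf]
    rfl
  · intro g
    refine ⟨homMk (fun X => ∑ i, N.act (E := E) (g (b.elt i)) X ∘ₗ b.coord i X)
      fun S x => ?_, ?_⟩
    · simp only [LinearMap.sum_apply, LinearMap.comp_apply, map_sum, b.coord_map, act_post]
    · refine LinearMap.ext fun x => ?_
      refine Eq.trans ?_ (congrArg g (b.sum_act E x))
      refine (LinearMap.sum_apply _ _ _).trans (Eq.trans ?_ (map_sum g _ _).symm)
      refine Finset.sum_congr rfl fun i _ => ?_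
      refine (N.act_eq_smul _ _).trans (Eq.trans ?_ (congrArg g (M.act_eq_smul _ _).symm))
      exact (map_smul g _ _).symm

/-- By the perfect pairing, a natural map from N to kC(E, -) amounts to a linear functional on N(E).
The coordinates of the extension of `g` come from the functionals `trace ∘ coord i ∘ g`. -/
theorem bijective_evalHom_right (N : CorrFunctor k) : Function.Bijective (evalHom N M E) := by
  have uniq {X : FinCorr.{u}} {a a' : MonoidAlgebra k (E ⟶ X)}
      (h : ∀ S : X ⟶ E, trace E (post S a) = trace E (post S a')) : a = a' :=
    sub_eq_zero.1 (eq_zero_of_trace_post_eq_zero _ fun S => by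
      rw [map_sub, map_sub, h, sub_self])
  constructor
  · rw [injective_iff_map_eq_zero]
    intro f hf
    refine hom_ext_apply fun X x => b.eq_zero_of_map_eq_zero _ fun S => ?_
    rw [← naturality_apply, ← evalHom_apply, hf]
    rfl
  · intro g
    have ex (i : Fin b.n) (X : FinCorr.{u}) (y : N.obj X) :
        ∃ a : MonoidAlgebra k (E ⟶ X), ∀ S : X ⟶ E, trace E (post S a) =
          trace E (b.coord i E (g ((N.map S).hom y))) := exists_trace_post_eq _
    choose ψ hψ using ex
    have ψ_map (i : Fin b.n) {X Y : FinCorr.{u}} (S : X ⟶ Y) (y : N.obj X) :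
        ψ i Y ((N.map S).hom y) = post S (ψ i X y) := uniq fun T => by
      rw [hψ, ← post_comp, hψ, map_comp_apply]
    let ψl (i : Fin b.n) (X : FinCorr.{u}) : N.obj X →ₗ[k] MonoidAlgebra k (E ⟶ X) :=
      { toFun := ψ i X
        map_add' := fun x y => uniq fun S => by
          rw [map_add (post S), map_add (trace E), hψ, hψ, hψ, map_add (N.map S).hom]
          refine (congrArg (trace E ∘ₗ b.coord i E) (map_add g _ _)).trans ?_
          exact map_add (trace E ∘ₗ b.coord i E) _ _
        map_smul' := fun c x => uniq fun S => by
          rw [RingHom.id_apply, map_smul (post S), map_smul (trace E), hψ, hψ,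
            map_smul (N.map S).hom]
          refine (congrArg (trace E ∘ₗ b.coord i E) (LinearMap.map_smul_of_tower g c _)).trans ?_
          exact map_smul (trace E ∘ₗ b.coord i E) _ _ }
    have ψl_apply (i X y) : ψl i X y = ψ i X y := rfl
    -- Only here does the compatibility of `g` with correspondences enter: it makes the extension
    -- restrict to `g` at `E`.
    have ψ_E (i : Fin b.n) (y : N.obj E) : ψ i E y = b.coord i E (g y) := uniq fun S => by
      rw [hψ, objHom_map, b.coord_map]
    refine ⟨homMk (fun X => ∑ i, M.act (b.elt i) X ∘ₗ ψl i X) fun S x => ?_, ?_⟩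
    · simp only [LinearMap.sum_apply, LinearMap.comp_apply, map_sum, ψl_apply, ψ_map, act_post]
    · refine LinearMap.ext fun y => ?_
      refine Eq.trans ((LinearMap.sum_apply _ _ _).trans ?_) (b.sum_act E (g y))
      refine Finset.sum_congr rfl fun i _ => ?_
      exact congrArg (M.act (b.elt i) E) (ψ_E i y)

end DualBasis

end CorrFunctor

/-! ### Functors generated and detected at one set. -/

namespace CorrFunctor

open FinCorr

variable {k : Type u} [Field k]

theorem FinitelyGenerated.finite_obj {M : CorrFunctor k} (h : M.FinitelyGenerated)
    (X : FinCorr.{u}) : Module.Finite k (M.obj X) := by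
  obtain ⟨n, E, m, h⟩ := h
  refine ⟨Submodule.fg_def.2 ⟨_, ?_, eq_top_iff.2 fun x _ => h X x⟩⟩
  refine (Set.finite_range fun p : Σ i, (E i ⟶ X) => (M.map p.2).hom (m p.1)).subset ?_
  rintro y ⟨i, S, rfl⟩
  exact ⟨⟨i, S⟩, rfl⟩

/-- The functor `M` is generated by its value at `E`. -/
def GeneratedAt (M : CorrFunctor k) (E : FinCorr.{u}) : Prop :=
  ∀ (X : FinCorr.{u}) (x : M.obj X),
    x ∈ Submodule.span k {y : M.obj X | ∃ (m : M.obj E) (S : E ⟶ X), y = (M.map S).hom m}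

/-- Elements of the functor `M` are detected by correspondences to `E`. -/
def DetectedAt (M : CorrFunctor k) (E : FinCorr.{u}) : Prop :=
  ∀ (X : FinCorr.{u}) (x : M.obj X), (∀ S : X ⟶ E, (M.map S).hom x = 0) → x = 0

/-- Each `F i` is a retract of the disjoint union `E`, so generators can be moved to `E` and
recovered. -/
theorem FinitelyGenerated.exists_single {M : CorrFunctor k} (h : M.FinitelyGenerated) :
    ∃ (E : FinCorr.{u}) (n : ℕ) (m : Fin n → M.obj E), ∀ (X : FinCorr.{u}) (x : M.obj X),
      x ∈ Submodule.span k {y : M.obj X | ∃ (i : Fin n) (S : E ⟶ X), y = (M.map S).hom (m i)} := by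
  obtain ⟨n, F, m, h⟩ := h
  let E : FinCorr.{u} := ⟨Σ i, (F i).carrier⟩
  let s (i : Fin n) : F i ⟶ E := ⟨{p | p.1 = ⟨i, p.2⟩}⟩
  let r (i : Fin n) : E ⟶ F i := opposite (F i) E (s i)
  have hsr (i : Fin n) : s i ≫ r i = 𝟙 (F i) := by
    refine Hom.ext (Set.ext fun ⟨y, x⟩ => ?_)
    change (∃ e : E.carrier, e = ⟨i, y⟩ ∧ e = ⟨i, x⟩) ↔ y = x
    constructor
    · rintro ⟨_, rfl, h⟩
      exact eq_of_heq (Sigma.mk.inj h).2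
    · rintro rfl
      exact ⟨_, rfl, rfl⟩
  refine ⟨E, n, fun i => (M.map (s i)).hom (m i), fun X x => Submodule.span_mono ?_ (h X x)⟩
  rintro y ⟨i, S, rfl⟩
  refine ⟨i, r i ≫ S, ?_⟩
  rw [← map_comp_apply, ← Category.assoc, hsr, Category.id_comp]

/-- The direct sum of `n` copies of the functor represented by `E`. -/
noncomputable def freeFunctor (k : Type u) [Field k] (n : ℕ) (E : FinCorr.{u}) : CorrFunctor k where
  obj X := ModuleCat.of k (Fin n → MonoidAlgebra k (E ⟶ X))
  map S := ModuleCat.ofHom (LinearMap.pi fun i => post S ∘ₗ LinearMap.proj i)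
  map_id X := by
    ext1
    exact LinearMap.ext fun x => funext fun i => post_id (x i)
  map_comp S T := by
    ext1
    exact LinearMap.ext fun x => funext fun i => post_comp S T (x i)

/-- Generators at `E` give an epimorphism from a free functor; projectivity splits it, and the
components of the section are the coordinates. -/
theorem exists_dualBasis {M : CorrFunctor k} (h : M.FinitelyGenerated) (hp : Projective M) :
    ∃ (E : FinCorr.{u}), M.GeneratedAt E ∧ Nonempty (M.DualBasis E) := by
  obtain ⟨E, n, m, hm⟩ := h.exists_single
  refine ⟨E, fun X x => Submodule.span_mono ?_ (hm X x), ?_⟩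
  · rintro y ⟨i, S, rfl⟩
    exact ⟨m i, S, rfl⟩
  let π : freeFunctor k n E ⟶ M := homMk
    (M := freeFunctor k n E) (fun X => ∑ i, M.act (m i) X ∘ₗ LinearMap.proj i) fun {X Y} S x => by
      simp only [LinearMap.sum_apply, map_sum]
      exact Finset.sum_congr rfl fun i _ => act_post M (m i) S (x i)
  have hπ (X : FinCorr.{u}) (x : (freeFunctor k n E).obj X) :
      (π.app X).hom x = ∑ i, M.act (m i) X (x i) :=
    LinearMap.sum_apply _ _ _
  have : ∀ X, Epi (π.app X) := fun X => by
    rw [ModuleCat.epi_iff_surjective, ← LinearMap.range_eq_top (f := (π.app X).hom), eq_top_iff]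
    refine fun x _ => Submodule.span_le.2 ?_ (hm X x)
    rintro y ⟨i, S, rfl⟩
    refine ⟨Pi.single i (MonoidAlgebra.single S 1), ?_⟩
    refine (hπ X _).trans ?_
    rw [Finset.sum_eq_single i]
    · rw [Pi.single_eq_same, act_single]
    · intro j _ hj
      rw [Pi.single_eq_of_ne hj, map_zero]
    · simp
  have : Epi π := NatTrans.epi_of_epi_app π
  let σ : M ⟶ freeFunctor k n E := Projective.factorThru (𝟙 M) π
  have hσ : σ ≫ π = 𝟙 M := Projective.factorThru_comp _ _
  refine ⟨⟨n, m, fun i X => LinearMap.proj i ∘ₗ (σ.app X).hom, fun i X Y S x => ?_, fun X x => ?_⟩⟩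
  · exact congrFun (naturality_apply σ S x) i
  · have := congrArg (fun f => (f.app X).hom x) hσ
    exact (hπ X _).symm.trans this

/-- The image of a combination of elements `F(R) m` should be the same combination of `G(R) (θ m)`.
Its images at `E` depend only on the original element, so detection makes this well defined. -/
theorem exists_hom_of_fiber {F G : CorrFunctor k} {E : FinCorr.{u}} (hF : F.GeneratedAt E)
    (hG : G.DetectedAt E) (θ : F.obj E →ₗ[k] G.obj E)
    (hθ : ∀ (R : E ⟶ E) x, θ ((F.map R).hom x) = (G.map R).hom (θ x)) :
    ∃ α : F ⟶ G, ∀ x : F.obj E, (α.app E).hom x = θ x := by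
  have uniq {X : FinCorr.{u}} {y y' : G.obj X}
      (h : ∀ S : X ⟶ E, (G.map S).hom y = (G.map S).hom y') : y = y' :=
    sub_eq_zero.1 (hG X _ fun S => by rw [map_sub, h, sub_self])
  have ex (X : FinCorr.{u}) (x : F.obj X) :
      ∃ y : G.obj X, ∀ S : X ⟶ E, (G.map S).hom y = θ ((F.map S).hom x) := by
    induction hF X x using Submodule.span_induction with
    | mem x hx =>
      obtain ⟨m, R, rfl⟩ := hx
      exact ⟨(G.map R).hom (θ m), fun S => by
        rw [← map_comp_apply, ← map_comp_apply, hθ]⟩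
    | zero => exact ⟨0, by simp⟩
    | add x y _ _ hx hy =>
      obtain ⟨a, ha⟩ := hx
      obtain ⟨b, hb⟩ := hy
      exact ⟨a + b, fun S => by simp only [map_add, ha, hb]⟩
    | smul c x _ hx =>
      obtain ⟨a, ha⟩ := hx
      exact ⟨c • a, fun S => by simp only [map_smul, ha]⟩
  choose α hα using ex
  refine ⟨homMk (fun X =>
    { toFun := α X
      map_add' := fun x y => uniq fun S => by simp only [map_add, hα]
      map_smul' := fun c x => uniq fun S => by simp only [map_smul, hα, RingHom.id_apply] })
    fun S x => uniq fun T => ?_, fun x => ?_⟩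
  · change (G.map T).hom (α _ _) = (G.map T).hom ((G.map S).hom (α _ _))
    rw [hα, ← map_comp_apply, ← map_comp_apply, hα]
  · change α E x = θ x
    rw [← map_id_apply G (α E x), hα, map_id_apply]

theorem hom_ext_of_detectedAt {F G : CorrFunctor k} {E : FinCorr.{u}} (hG : G.DetectedAt E)
    {α β : F ⟶ G} (h : ∀ x : F.obj E, (α.app E).hom x = (β.app E).hom x) : α = β :=
  hom_ext_apply fun X x => sub_eq_zero.1 (hG X _ fun S => by
    rw [map_sub, ← naturality_apply, ← naturality_apply, h, sub_self])

theorem nonempty_iso_of_fiber {F G : CorrFunctor k} {E : FinCorr.{u}} (hF : F.GeneratedAt E)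
    (hF' : F.DetectedAt E) (hG : G.GeneratedAt E) (hG' : G.DetectedAt E)
    (θ : F.obj E ≃ₗ[k] G.obj E)
    (hθ : ∀ (R : E ⟶ E) x, θ ((F.map R).hom x) = (G.map R).hom (θ x)) : Nonempty (F ≅ G) := by
  obtain ⟨α, hα⟩ := exists_hom_of_fiber hF hG' θ.toLinearMap hθ
  obtain ⟨β, hβ⟩ := exists_hom_of_fiber hG hF' θ.symm.toLinearMap fun R x => by
    apply θ.injective
    simp [hθ]
  refine ⟨⟨α, β, hom_ext_of_detectedAt hF' fun x => ?_, hom_ext_of_detectedAt hG' fun x => ?_⟩⟩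
  · change (β.app E).hom ((α.app E).hom x) = x
    simp [hα, hβ]
  · change (α.app E).hom ((β.app E).hom x) = x
    simp [hα, hβ]

/-! ### Subfunctors, radical and socle compared with their values at `E`. -/

namespace Sub

variable {M : CorrFunctor k} {E : FinCorr.{u}}

/-- The value at `E` of a subfunctor, as a submodule. -/
noncomputable def eval (N : Sub M) (E : FinCorr.{u}) :
    Submodule (MonoidAlgebra k (End E)) (M.obj E) :=
  MonoidAlgebra.submoduleOfSMulMem (N.obj E) fun R x hx => by
    rw [MonoidAlgebra.of_apply, single_smul_obj]
    exact N.map_mem _ hx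

theorem mem_eval {N : Sub M} {x : M.obj E} : x ∈ N.eval E ↔ x ∈ N.obj E := Iff.rfl

theorem map_mem_submodule (W : Submodule (MonoidAlgebra k (End E)) (M.obj E)) (R : E ⟶ E)
    {x : M.obj E} (hx : x ∈ W) : (M.map R).hom x ∈ W := by
  rw [← M.single_smul_obj (show End E from R)]
  exact W.smul_mem _ hx

/-- The largest subfunctor with a given value at `E`. -/
noncomputable def largest (W : Submodule (MonoidAlgebra k (End E)) (M.obj E)) : Sub M where
  obj X :=
    { carrier := {x | ∀ S : X ⟶ E, (M.map S).hom x ∈ W}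
      zero_mem' := fun S => by rw [map_zero]; exact W.zero_mem
      add_mem' := fun hx hy S => by rw [map_add]; exact W.add_mem (hx S) (hy S)
      smul_mem' := fun c x hx S => by
        rw [map_smul]
        exact (W.restrictScalars k).smul_mem c (hx S) }
  map_mem S x hx T := by
    rw [← map_comp_apply]
    exact hx _

/-- The subfunctor generated by a submodule of the value at `E`. -/
noncomputable def generated (W : Submodule (MonoidAlgebra k (End E)) (M.obj E)) : Sub M where
  obj X := Submodule.span k {y | ∃ m ∈ W, ∃ S : E ⟶ X, y = (M.map S).hom m}
  map_mem {X Y} S x hx := by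
    have : Submodule.span k {y | ∃ m ∈ W, ∃ S : E ⟶ X, y = (M.map S).hom m} ≤
        (Submodule.span k {y | ∃ m ∈ W, ∃ S : E ⟶ Y, y = (M.map S).hom m}).comap
          (M.map S).hom := by
      rw [Submodule.span_le]
      rintro _ ⟨m, hm, R, rfl⟩
      exact Submodule.subset_span ⟨m, hm, R ≫ S, (map_comp_apply M R S m).symm⟩
    exact this hx

theorem eval_mono {N N' : Sub M} (h : N ≤ N') : N.eval E ≤ N'.eval E := fun _ hx => h E hx

theorem eval_largest (W : Submodule (MonoidAlgebra k (End E)) (M.obj E)) :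
    (largest W).eval E = W := by
  ext x
  refine ⟨fun hx => ?_, fun hx S => map_mem_submodule W S hx⟩
  have := hx (𝟙 E)
  rwa [map_id_apply] at this

theorem le_largest {N : Sub M} {W : Submodule (MonoidAlgebra k (End E)) (M.obj E)}
    (h : N.eval E ≤ W) : N ≤ largest W := fun _ _ hx S => h (N.map_mem S hx)

theorem generated_le {N : Sub M} {W : Submodule (MonoidAlgebra k (End E)) (M.obj E)}
    (h : W ≤ N.eval E) : generated W ≤ N := by
  refine fun X => Submodule.span_le.2 ?_
  rintro _ ⟨m, hm, S, rfl⟩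
  exact N.map_mem S (h hm)

theorem eval_generated (W : Submodule (MonoidAlgebra k (End E)) (M.obj E)) :
    (generated W).eval E = W := by
  apply le_antisymm
  · have : generated W ≤ largest W := generated_le (by rw [eval_largest])
    exact (eval_mono this).trans (eval_largest W).le
  · intro x hx
    exact (Submodule.subset_span ⟨x, hx, 𝟙 E, (M.map_id_apply x).symm⟩ :
      x ∈ (generated W).obj E)

theorem eval_eq_top (hM : M.GeneratedAt E) {N : Sub M} : N.eval E = ⊤ ↔ N = ⊤ := by
  refine ⟨fun h => top_unique fun X x _ => Submodule.span_le.2 ?_ (hM X x), ?_⟩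
  · rintro _ ⟨m, S, rfl⟩
    exact N.map_mem S (mem_eval.1 (h ▸ Submodule.mem_top))
  · rintro rfl
    rfl

theorem eval_eq_bot (hM : M.DetectedAt E) {N : Sub M} : N.eval E = ⊥ ↔ N = ⊥ := by
  refine ⟨fun h => bot_unique fun X x hx => hM X x fun S => ?_, ?_⟩
  · have : (M.map S).hom x ∈ N.eval E := N.map_mem S hx
    rwa [h] at this
  · rintro rfl
    rfl

/-- The larger subfunctor has the same value at `E`, which is proper by generation, so maximality
forces equality. -/
theorem largest_eval_of_isCoatom (hM : M.GeneratedAt E) {N : Sub M} (hN : IsCoatom N) :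
    largest (N.eval E) = N := by
  refine ((hN.le_iff.1 (le_largest le_rfl)).resolve_left fun h => hN.1 ?_)
  rw [← eval_eq_top hM (E := E), ← eval_largest (N.eval E), h]
  rfl

theorem generated_eval_of_isAtom (hM : M.DetectedAt E) {N : Sub M} (hN : IsAtom N) :
    generated (N.eval E) = N := by
  refine ((hN.le_iff.1 (generated_le le_rfl)).resolve_left fun h => hN.1 ?_)
  rw [← eval_eq_bot hM (E := E), ← eval_generated (N.eval E), h]
  rfl

theorem isCoatom_eval (hM : M.GeneratedAt E) {N : Sub M} (hN : IsCoatom N) :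
    IsCoatom (N.eval E) := by
  refine ⟨fun h => hN.1 ((eval_eq_top hM).1 h), fun W hW => ?_⟩
  rw [← eval_largest W, eval_eq_top hM]
  refine hN.2 _ (lt_of_le_of_ne (le_largest hW.le) ?_)
  rintro h
  rw [h, eval_largest] at hW
  exact lt_irrefl _ hW

theorem isCoatom_largest (hM : M.GeneratedAt E)
    {W : Submodule (MonoidAlgebra k (End E)) (M.obj E)} (hW : IsCoatom W) :
    IsCoatom (largest W) := by
  refine ⟨fun h => hW.1 ?_, fun N hN => (eval_eq_top hM).1 (hW.2 _ (lt_of_le_of_ne ?_ ?_))⟩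
  · rw [← eval_largest W, h]
    rfl
  · conv_lhs => rw [← eval_largest W]
    exact eval_mono hN.le
  · intro h
    exact hN.not_ge (le_largest h.ge)

theorem isAtom_eval (hM : M.DetectedAt E) {N : Sub M} (hN : IsAtom N) :
    IsAtom (N.eval E) := by
  refine ⟨fun h => hN.1 ((eval_eq_bot hM).1 h), fun W hW => ?_⟩
  rw [← eval_generated W, eval_eq_bot hM]
  refine hN.2 _ (lt_of_le_of_ne (generated_le hW.le) ?_)
  rintro h
  rw [← h, eval_generated] at hW
  exact lt_irrefl _ hW

theorem isAtom_generated (hM : M.DetectedAt E)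
    {W : Submodule (MonoidAlgebra k (End E)) (M.obj E)} (hW : IsAtom W) :
    IsAtom (generated W) := by
  refine ⟨fun h => hW.1 ?_, fun N hN => (eval_eq_bot hM).1 (hW.2 _ (lt_of_le_of_ne ?_ ?_))⟩
  · rw [← eval_generated W, h]
    rfl
  · conv_rhs => rw [← eval_generated W]
    exact eval_mono hN.le
  · intro h
    exact hN.not_ge (generated_le h.ge)

theorem mem_inter {A : Set (Sub M)} {X : FinCorr.{u}} {x : M.obj X} :
    x ∈ (inter A).obj X ↔ ∀ N ∈ A, x ∈ N.obj X := by
  simp [inter]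

theorem le_sum {A : Set (Sub M)} {N : Sub M} (hN : N ∈ A) : N ≤ sum A :=
  fun X => le_iSup₂_of_le (f := fun N (_ : N ∈ A) => N.obj X) N hN le_rfl

theorem sum_le {A : Set (Sub M)} {N : Sub M} (h : ∀ N' ∈ A, N' ≤ N) : sum A ≤ N :=
  fun X => iSup₂_le fun N' hN' => h N' hN' X

/-- `eval` and `largest` match maximal subfunctors with maximal submodules, and intersections are
computed pointwise. -/
theorem eval_radical (hM : M.GeneratedAt E) :
    M.radical.eval E = Module.jacobson (MonoidAlgebra k (End E)) (M.obj E) := by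
  refine le_antisymm (le_sInf fun W hW => ?_) fun x hx => mem_inter.2 fun N hN => ?_
  · rw [← eval_largest W]
    exact fun x hx => mem_inter.1 hx _ (isCoatom_largest hM hW)
  · exact (sInf_le (isCoatom_eval hM hN) :
      Module.jacobson (MonoidAlgebra k (End E)) (M.obj E) ≤ N.eval E) hx

theorem eval_socle (hM : M.DetectedAt E) :
    M.socle.eval E = sSup {W | IsAtom W} := by
  refine le_antisymm ?_ (sSup_le fun W hW => ?_)
  · rw [← eval_largest (sSup {W | IsAtom W})]
    exact eval_mono (sum_le fun N hN => le_largest (le_sSup (isAtom_eval hM hN)))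
  · rw [← eval_generated W]
    exact eval_mono (le_sum (isAtom_generated hM hW))

theorem generatedAt_quotient (hM : M.GeneratedAt E) (N : Sub M) : N.quotient.GeneratedAt E := by
  intro X x
  obtain ⟨x, rfl⟩ := (N.obj X).mkQ_surjective x
  let q : M.obj X →ₗ[k] N.quotient.obj X := (N.obj X).mkQ
  have key : Submodule.span k {y : M.obj X | ∃ (m : M.obj E) (S : E ⟶ X), y = (M.map S).hom m} ≤
      (Submodule.span k {y : N.quotient.obj X | ∃ (m : N.quotient.obj E) (S : E ⟶ X),
        y = (N.quotient.map S).hom m}).comap q := by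
    refine Submodule.span_le.2 ?_
    rintro _ ⟨m, S, rfl⟩
    exact Submodule.subset_span ⟨(N.obj E).mkQ m, S, rfl⟩
  exact key (hM X x)

theorem detectedAt_toFunctor (hM : M.DetectedAt E) (N : Sub M) : N.toFunctor.DetectedAt E :=
  fun X x h => Subtype.ext (hM X x.1 fun S => congrArg Subtype.val (h S))

/-- A maximal subfunctor is the `largest` one with its value at `E`, so membership in it can be
tested after correspondences to `E`. -/
theorem detectedAt_quotient_radical (hM : M.GeneratedAt E) :
    M.radical.quotient.DetectedAt E := by
  intro X x h
  obtain ⟨x, rfl⟩ := (M.radical.obj X).mkQ_surjective x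
  refine (Submodule.Quotient.mk_eq_zero _).2 (mem_inter.2 fun N hN => ?_)
  rw [← largest_eval_of_isCoatom hM hN]
  intro S
  exact mem_inter.1 ((Submodule.Quotient.mk_eq_zero _).1 (h S)) N hN

/-- Each simple subfunctor is generated by its value at `E`, hence so is their sum. -/
theorem generatedAt_toFunctor_socle (hM : M.DetectedAt E) :
    M.socle.toFunctor.GeneratedAt E := by
  have hle : M.socle ≤ generated (M.socle.eval E) := sum_le fun N hN => by
    rw [← generated_eval_of_isAtom hM hN]
    refine generated_le ?_
    rw [eval_generated]
    exact eval_mono (le_sum hN)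
  rintro X ⟨x, hx⟩
  let i : M.socle.toFunctor.obj X →ₗ[k] M.obj X := (M.socle.obj X).subtype
  have key : (generated (M.socle.eval E)).obj X ≤ (Submodule.span k
      {y : M.socle.toFunctor.obj X | ∃ (m : M.socle.toFunctor.obj E) (S : E ⟶ X),
        y = (M.socle.toFunctor.map S).hom m}).map i := by
    refine Submodule.span_le.2 ?_
    rintro _ ⟨m, hm, S, rfl⟩
    exact ⟨_, Submodule.subset_span ⟨⟨m, hm⟩, S, rfl⟩, rfl⟩
  obtain ⟨y, hy, hyx⟩ := key (hle X hx)
  exact (Subtype.ext hyx : y = ⟨x, hx⟩) ▸ hy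

end Sub

/-! ### The two assertions. -/

theorem nonempty_iso_quotient_radical_socle {M : CorrFunctor k} (h : M.FinitelyGenerated)
    (hp : Projective M) : Nonempty (M.radical.quotient ≅ M.socle.toFunctor) := by
  obtain ⟨E, hM, ⟨b⟩⟩ := exists_dualBasis h hp
  have hM' : M.DetectedAt E := fun X x => b.eq_zero_of_map_eq_zero x
  have := h.finite_obj E
  obtain ⟨e⟩ := nonempty_linearEquiv_quotient_jacobson_socle (k := k)
    (A := MonoidAlgebra k (End E)) (M.obj E) fun S _ _ _ _ _ _ => b.finrank_objHom_comm
  rw [← Sub.eval_radical hM, ← Sub.eval_socle hM'] at e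
  -- The module isomorphism at `E`, read between the values of the two functors; its linearity over
  -- the algebra is the compatibility needed to extend it.
  let θ : M.radical.quotient.obj E ≃ₗ[k] M.socle.toFunctor.obj E :=
    (Submodule.Quotient.restrictScalarsEquiv k (M.radical.eval E)).trans (e.restrictScalars k)
  refine nonempty_iso_of_fiber (Sub.generatedAt_quotient hM _)
    (Sub.detectedAt_quotient_radical hM) (Sub.generatedAt_toFunctor_socle hM')
    (Sub.detectedAt_toFunctor hM' _) θ fun R x => ?_
  obtain ⟨x, rfl⟩ := (M.radical.obj E).mkQ_surjective x
  have h1 := e.map_smul (MonoidAlgebra.single (show End E from R) (1 : k))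
    ((M.radical.eval E).mkQ x)
  rw [← map_smul, single_smul_obj] at h1
  refine h1.trans (Subtype.ext ?_)
  exact M.single_smul_obj (show End E from R) _

theorem finrank_hom_comm {M N : CorrFunctor k} (hM : M.FinitelyGenerated)
    (hN : N.FinitelyGenerated) (hp : Projective M) :
    Module.Finite k (M ⟶ N) ∧ Module.Finite k (N ⟶ M) ∧
      Module.finrank k (M ⟶ N) = Module.finrank k (N ⟶ M) := by
  obtain ⟨E, -, ⟨b⟩⟩ := exists_dualBasis hM hp
  have := hM.finite_obj E
  have := hN.finite_obj E
  let e := LinearEquiv.ofBijective (evalHom M N E) (b.bijective_evalHom_left N)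
  let e' := LinearEquiv.ofBijective (evalHom N M E) (b.bijective_evalHom_right N)
  have := Module.Finite.linearMap_of_algebra (k := k) (A := MonoidAlgebra k (End E))
    (M.obj E) (N.obj E)
  have := Module.Finite.linearMap_of_algebra (k := k) (A := MonoidAlgebra k (End E))
    (N.obj E) (M.obj E)
  exact ⟨Module.Finite.equiv e.symm, Module.Finite.equiv e'.symm, by
    rw [e.finrank_eq, e'.finrank_eq, b.finrank_objHom_comm]⟩

end CorrFunctor

theorem mainTheorem12 (k : Type u) [Field k] :
    (∀ M : CorrFunctor k, M.FinitelyGenerated → Projective M →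
      Nonempty (M.radical.quotient ≅ M.socle.toFunctor)) ∧
    (∀ M N : CorrFunctor k, M.FinitelyGenerated → N.FinitelyGenerated → Projective M →
      Module.Finite k (M ⟶ N) ∧ Module.Finite k (N ⟶ M) ∧
        Module.finrank k (M ⟶ N) = Module.finrank k (N ⟶ M)) :=
  ⟨fun _ h hp => CorrFunctor.nonempty_iso_quotient_radical_socle h hp,
    fun _ _ hM hN hp => CorrFunctor.finrank_hom_comm hM hN hp⟩
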